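/- An MV-algebra is an Abelian monoid $(A,\oplus,0)$ with an involution $\neg$ such that $\neg 0\oplus x=\neg 0$ and $\neg(\neg x\oplus y)\oplus y=\neg(\neg y\oplus x)\oplus x$ for all $x,y$; put $x\le y$ iff $\neg x\oplus y=\neg 0$. The interval $[0,1]$ is an MV-algebra under $x\oplus y=\min\{x+y,1\}$, $\neg x=1-x$, and for $n\ge 2$, $\text{Ł}_n=\{0,\frac1{n-1},\dots,\frac{n-2}{n-1},1\}$ is a subalgebra of it. An ideal is a nonempty subset closed under $\oplus$ and downward closed; a maximal ideal is a maximal proper ideal; an ideal is principal if it is generated by one element. An MV-algebra is profinite if it is isomorphic to the inverse limit, in the category of MV-algebras, of an inverse system of finite MV-algebras indexed by a directed poset. A homomorphism $\varphi:A\to B$ reflects principal maximal ideals if $\varphi^{-1}(M)$ is a principal maximal ideal of $A$ for every principal maximal ideal $M$ of $B$. Let $\mathbb{P}$ be the category of profinite MV-algebras and homomorphisms that reflect principal maximal ideals. Let $\mathbb{M}$ be the category of multisets: its objects are pairs $\langle X,\sigma\rangle$ of a set $X$ and a map $\sigma$ from $X$ to the positive integers, and its morphisms $\langle X,\sigma\rangle\to\langle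 Y,\mu\rangle$ are the maps $\varphi:X\to Y$ such that $\mu(\varphi(x))$ divides $\sigma(x)$ for all $x\in X$. Then $\mathbb{M}$ is dually equivalent to $\mathbb{P}$. More precisely: (1) For a profinite MV-algebra $A$ let $\mathcal{H}_F(A)$ be the set of homomorphisms $\chi:A\to[0,1]$ whose kernel $\{a:\chi(a)=0\}$ is a principal (maximal) ideal of $A$, and put $\sigma_A(\chi)=\#\chi(A)-1$. Each $\chi(A)$ is finite and $\sigma_A(\chi)\geq 1$, and $\mathcal{H}(A)=\langle\mathcal{H}_F(A),\sigma_A\rangle$, $\mathcal{H}(\varphi)(\chi)=\chi\circ\varphi$ defines a functor $\mathcal{H}:\mathbb{P}^{op}\to\mathbb{M}$. (2) $\mathcal{F}(\langle X,\sigma\rangle)=\prod_{x\in X}\text{Ł}_{\sigma(x)+1}$, $\mathcal{F}(\varphi)(f)(x)=f(\varphi(x))$ defines a functor $\mathcal{F}:\mathbb{M}\to\mathbb{P}^{op}$. (3) There are natural isomorphisms $\eta:\mathrm{Id}_{\mathbb{M}}\to\mathcal{H}\circ\mathcal{F}$, with $\eta_X(x)(f)=f(x)$, and $\varepsilon:\mathcal{F}\circ\mathcal{H}\to\mathrm{Id}_{\mathbb{P}^{op}}$,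 whose component at $A$ is the homomorphism $\varepsilon_A:A\to\prod_{\chi\in\mathcal{H}_F(A)}\text{Ł}_{\#\chi(A)}$ with $\varepsilon_A(a)(\chi)=\chi(a)$. They satisfy the triangle identities, so that $\mathcal{F}$, $\mathcal{H}$, $\eta$, $\varepsilon$ form an equivalence between $\mathbb{M}$ and $\mathbb{P}^{op}$ with unit $\eta$ and counit $\varepsilon$. -/

import Mathlib

open CategoryTheory CategoryTheory.Limits

universe u v w

/-! ### MV-algebras, homomorphisms, ideals -/

/-- An MV-algebra: an Abelian monoid `(A, ⊕, 0)` with an involution `¬` such that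
`¬0 ⊕ x = ¬0` and `¬(¬x ⊕ y) ⊕ y = ¬(¬y ⊕ x) ⊕ x`. -/
class MVAlgebra (A : Type u) where
  oplus : A → A → A
  zero : A
  neg : A → A
  oplus_assoc : ∀ x y z, oplus (oplus x y) z = oplus x (oplus y z)
  oplus_comm : ∀ x y, oplus x y = oplus y x
  oplus_zero : ∀ x, oplus x zero = x
  neg_neg : ∀ x, neg (neg x) = x
  neg_zero_oplus : ∀ x, oplus (neg zero) x = neg zero
  luk : ∀ x y, oplus (neg (oplus (neg x) y)) y = oplus (neg (oplus (neg y) x)) x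

namespace MVAlgebra

variable {A : Type u} {B : Type v} {C : Type w} [MVAlgebra A] [MVAlgebra B] [MVAlgebra C]

/-- `x ≤ y` iff `¬x ⊕ y = 1`, where `1 = ¬0`. -/
def le (x y : A) : Prop := oplus (neg x) y = neg zero

variable (A B) in
/-- Homomorphisms of MV-algebras. -/
@[ext]
structure Hom where
  toFun : A → B
  map_zero : toFun zero = zero
  map_oplus : ∀ x y, toFun (oplus x y) = oplus (toFun x) (toFun y)
  map_neg : ∀ x, toFun (neg x) = neg (toFun x)

instance : CoeFun (Hom A B) (fun _ => A → B) := ⟨Hom.toFun⟩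

variable (A) in
/-- The identity homomorphism. -/
def Hom.id : Hom A A := ⟨fun a => a, rfl, fun _ _ => rfl, fun _ => rfl⟩

/-- The composite `g ∘ f`. -/
def Hom.comp (g : Hom B C) (f : Hom A B) : Hom A C where
  toFun a := g (f a)
  map_zero := by rw [f.map_zero, g.map_zero]
  map_oplus x y := by rw [f.map_oplus, g.map_oplus]
  map_neg x := by rw [f.map_neg, g.map_neg]

/-- Ideals: nonempty, closed under `⊕`, downward closed. -/
structure IsIdeal (I : Set A) : Prop where
  nonempty : I.Nonempty
  oplus_mem : ∀ x ∈ I, ∀ y ∈ I, oplus x y ∈ I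
  mem_of_le : ∀ x, ∀ y ∈ I, le x y → x ∈ I

/-- Maximal ideals: maximal among the proper ideals. -/
structure IsMaximalIdeal (M : Set A) : Prop where
  isIdeal : IsIdeal M
  ne_univ : M ≠ Set.univ
  eq_of_subset : ∀ J : Set A, IsIdeal J → J ≠ Set.univ → M ⊆ J → M = J

/-- The ideal generated by `a`: the intersection of all ideals containing `a`. -/
def idealSpan (a : A) : Set A := {x | ∀ J : Set A, IsIdeal J → a ∈ J → x ∈ J}

/-- Principal ideals: the ideals generated by a single element. -/
def IsPrincipalIdeal (I : Set A) : Prop := ∃ a : A, I = idealSpan a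

/-- Principal maximal ideals. -/
def IsPrincipalMaximal (M : Set A) : Prop := IsMaximalIdeal M ∧ IsPrincipalIdeal M

/-- The kernel of a homomorphism. -/
def Hom.ker (f : Hom A B) : Set A := {a | f a = zero}

/-- `f : A → B` reflects principal maximal ideals: the preimage of every principal maximal
ideal of `B` is a principal maximal ideal of `A`. -/
def Hom.ReflectsPrincipalMaximal (f : Hom A B) : Prop :=
  ∀ M : Set B, IsPrincipalMaximal M → IsPrincipalMaximal (f ⁻¹' M)

/-- Subalgebras of an MV-algebra. -/
structure Subalg (A : Type u) [MVAlgebra A] where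
  carrier : Set A
  zero_mem : zero ∈ carrier
  oplus_mem : ∀ x ∈ carrier, ∀ y ∈ carrier, oplus x y ∈ carrier
  neg_mem : ∀ x ∈ carrier, neg x ∈ carrier

instance : CoeSort (Subalg A) (Type u) := ⟨fun S => S.carrier⟩

instance (S : Subalg A) : MVAlgebra S where
  oplus x y := ⟨oplus x.1 y.1, S.oplus_mem _ x.2 _ y.2⟩
  zero := ⟨zero, S.zero_mem⟩
  neg x := ⟨neg x.1, S.neg_mem _ x.2⟩
  oplus_assoc _ _ _ := Subtype.ext (oplus_assoc _ _ _)
  oplus_comm _ _ := Subtype.ext (oplus_comm _ _)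
  oplus_zero _ := Subtype.ext (oplus_zero _)
  neg_neg _ := Subtype.ext (neg_neg _)
  neg_zero_oplus _ := Subtype.ext (neg_zero_oplus _)
  luk _ _ := Subtype.ext (luk _ _)

/-- Direct products, with pointwise operations. -/
instance {X : Type v} (L : X → Type w) [∀ x, MVAlgebra (L x)] : MVAlgebra (∀ x, L x) where
  oplus f g x := oplus (f x) (g x)
  zero _ := zero
  neg f x := neg (f x)
  oplus_assoc _ _ _ := funext fun _ => oplus_assoc _ _ _
  oplus_comm _ _ := funext fun _ => oplus_comm _ _
  oplus_zero _ := funext fun _ => oplus_zero _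
  neg_neg _ := funext fun _ => neg_neg _
  neg_zero_oplus _ := funext fun _ => neg_zero_oplus _
  luk _ _ := funext fun _ => luk _ _

/-- The standard MV-algebra `[0,1]`: `x ⊕ y = min (x + y) 1` and `¬x = 1 - x`. -/
noncomputable instance : MVAlgebra unitInterval where
  oplus x y := ⟨min ((x : ℝ) + y) 1,
    le_min (add_nonneg x.2.1 y.2.1) zero_le_one, min_le_right _ _⟩
  zero := 0
  neg x := ⟨1 - (x : ℝ), sub_nonneg.2 x.2.2, sub_le_self _ x.2.1⟩
  oplus_assoc x y z := by
    apply Subtype.ext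
    have hx := x.2.1
    have hz := z.2.1
    simp only [min_def]
    split_ifs <;> linarith
  oplus_comm x y := by
    apply Subtype.ext
    simp only [add_comm]
  oplus_zero x := by
    apply Subtype.ext
    simpa using x.2.2
  neg_neg x := by
    apply Subtype.ext
    simp
  neg_zero_oplus x := by
    apply Subtype.ext
    simpa using x.2.1
  luk x y := by
    apply Subtype.ext
    have hx := x.2.1
    have hy := y.2.1
    have hx' := x.2.2
    have hy' := y.2.2
    simp only [min_def]
    split_ifs <;> linarith

/-- The Łukasiewicz chain with `n ≥ 2` elements `0, 1/(n-1), …, (n-2)/(n-1), 1`,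
a subalgebra of `[0,1]`. -/
noncomputable def lukChain (n : ℕ) (hn : 2 ≤ n) : Subalg unitInterval where
  carrier := {t | ∃ k : ℕ, k < n ∧ (t : ℝ) = k / ((n : ℝ) - 1)}
  zero_mem := ⟨0, by omega, by simp [MVAlgebra.zero]⟩
  oplus_mem := by
    rintro x ⟨k, hk, hx⟩ y ⟨l, hl, hy⟩
    have hn' : (0 : ℝ) < (n : ℝ) - 1 := by
      have : (2 : ℝ) ≤ n := by exact_mod_cast hn
      linarith
    refine ⟨min (k + l) (n - 1), by omega, ?_⟩
    change min ((x : ℝ) + y) 1 = _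
    rw [hx, hy, ← add_div, Nat.cast_min, Nat.cast_sub (by omega), ← min_div_div_right hn'.le]
    simp [div_self hn'.ne']
  neg_mem := by
    rintro x ⟨k, hk, hx⟩
    have hn' : (0 : ℝ) < (n : ℝ) - 1 := by
      have : (2 : ℝ) ≤ n := by exact_mod_cast hn
      linarith
    refine ⟨n - 1 - k, by omega, ?_⟩
    change 1 - (x : ℝ) = _
    rw [hx, Nat.cast_sub (by omega), Nat.cast_sub (by omega), sub_div, Nat.cast_one,
      div_self hn'.ne']

end MVAlgebra

/-! ### The category of MV-algebras and profinite MV-algebras -/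

open MVAlgebra

/-- Bundled MV-algebras. -/
structure MVCat : Type (u + 1) where
  carrier : Type u
  [str : MVAlgebra carrier]

attribute [instance] MVCat.str

instance : CoeSort MVCat.{u} (Type u) := ⟨MVCat.carrier⟩

/-- The category of all MV-algebras and all homomorphisms. -/
instance : Category MVCat.{u} where
  Hom A B := MVAlgebra.Hom A B
  id A := MVAlgebra.Hom.id A
  comp f g := g.comp f

/-- `A` is profinite: it is isomorphic to the limit, in the category of MV-algebras, of an
inverse system of finite MV-algebras indexed by a directed poset. -/
def IsProfiniteMV (A : MVCat.{u}) : Prop :=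
  ∃ (I : Type u) (_ : PartialOrder I) (_ : IsDirectedOrder I) (D : Iᵒᵖ ⥤ MVCat.{u})
    (c : Cone D), (∀ i, Finite (D.obj i)) ∧ Nonempty (IsLimit c) ∧ Nonempty (A ≅ c.pt)

/-- Objects of `ℙ`: profinite MV-algebras. -/
structure ProfMV : Type (u + 1) where
  toMV : MVCat.{u}
  profinite : IsProfiniteMV toMV

instance : CoeSort ProfMV.{u} (Type u) := ⟨fun A => A.toMV⟩

/-- Morphisms of `ℙ`: homomorphisms that reflect principal maximal ideals. -/
@[ext]
structure ProfMV.Hom (A B : ProfMV.{u}) where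
  hom : MVAlgebra.Hom A B
  reflects : hom.ReflectsPrincipalMaximal

/-- The category `ℙ`. -/
instance : Category ProfMV.{u} where
  Hom A B := ProfMV.Hom A B
  id A := ⟨MVAlgebra.Hom.id A, fun _ h => h⟩
  comp f g := ⟨g.hom.comp f.hom, fun M h => f.reflects _ (g.reflects M h)⟩

/-! ### The category of multisets -/

/-- Objects of `𝕄`: a set `X` with a map `σ` from `X` to the positive integers. -/
structure MultisetCat : Type (u + 1) where
  carrier : Type u
  mult : carrier → ℕ
  mult_pos : ∀ x, 0 < mult x

instance : CoeSort MultisetCat.{u} (Type u) := ⟨MultisetCat.carrier⟩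

/-- Morphisms `⟨X, σ⟩ → ⟨Y, μ⟩` of `𝕄`: maps `φ` such that `μ (φ x)` divides `σ x`. -/
@[ext]
structure MultisetCat.Hom (X Y : MultisetCat.{u}) where
  toFun : X → Y
  dvd : ∀ x, Y.mult (toFun x) ∣ X.mult x

/-- The category `𝕄`. -/
instance : Category MultisetCat.{u} where
  Hom X Y := MultisetCat.Hom X Y
  id X := ⟨fun x => x, fun _ => dvd_rfl⟩
  comp f g := ⟨fun x => g.toFun (f.toFun x), fun x => (g.dvd _).trans (f.dvd x)⟩

/-! ### The functor `ℋ` -/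

/-- The set of homomorphisms `χ : A → [0,1]` whose kernel is a principal maximal ideal. -/
def HF (A : ProfMV.{u}) : Type u :=
  {χ : MVAlgebra.Hom A unitInterval // IsPrincipalMaximal χ.ker}

/-- `σ_A(χ) = #χ(A) - 1`. -/
noncomputable def sigmaHF (A : ProfMV.{u}) (χ : HF A) : ℕ := (Set.range χ.1).ncard - 1

/-- `χ ↦ χ ∘ φ`. -/
noncomputable def HF.precomp {A B : ProfMV.{u}} (φ : B ⟶ A) (χ : HF A) : HF B :=
  ⟨χ.1.comp φ.hom, φ.reflects χ.1.ker χ.2⟩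

/-- The functor `ℋ : ℙᵒᵖ ⥤ 𝕄`, with `ℋ(A) = ⟨HF A, σ_A⟩` and `ℋ(φ)(χ) = χ ∘ φ`, given that
the `σ_A` are well defined maps into the positive integers and that the `ℋ(φ)` are morphisms
of `𝕄`. -/
noncomputable def functorH
    (hσ : ∀ (A : ProfMV.{u}) (χ : HF A), (Set.range χ.1).Finite ∧ 0 < sigmaHF A χ)
    (hdvd : ∀ (A B : ProfMV.{u}) (φ : B ⟶ A) (χ : HF A),
      sigmaHF B (HF.precomp φ χ) ∣ sigmaHF A χ) :
    ProfMV.{u}ᵒᵖ ⥤ MultisetCat.{u} where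
  obj A := ⟨HF A.unop, sigmaHF A.unop, fun χ => (hσ A.unop χ).2⟩
  map {A B} φ := ⟨HF.precomp φ.unop, hdvd A.unop B.unop φ.unop⟩

/-! ### The functor `ℱ` -/

/-- The chain `Ł_{σ(x)+1}`. -/
noncomputable abbrev MultisetCat.chain (X : MultisetCat.{u}) (x : X) : Subalg unitInterval :=
  lukChain (X.mult x + 1) (Nat.succ_le_succ (X.mult_pos x))

/-- The MV-algebra `A_{X,σ} = ∏ x, Ł_{σ(x)+1}`. -/
noncomputable def MultisetCat.prodMV (X : MultisetCat.{u}) : MVCat.{u} :=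
  ⟨∀ x : X, X.chain x⟩

theorem MultisetCat.chain_subset {X Y : MultisetCat.{u}} (φ : X ⟶ Y) (x : X) :
    (Y.chain (φ.toFun x)).carrier ⊆ (X.chain x).carrier := by
  rintro t ⟨k, hk, ht⟩
  obtain ⟨d, hd⟩ := φ.dvd x
  have hX := X.mult_pos x
  have hd0 : 0 < d := Nat.pos_of_ne_zero (by rintro rfl; simp at hd; omega)
  refine ⟨k * d, ?_, ?_⟩
  · rw [hd]
    exact Nat.lt_succ_of_le (Nat.mul_le_mul_right d (Nat.le_of_lt_succ hk))
  · have hd' : (d : ℝ) ≠ 0 := by exact_mod_cast hd0.ne'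
    rw [ht, hd]
    push_cast
    simp only [add_sub_cancel_right]
    rw [mul_div_mul_right _ _ hd']

/-- The homomorphism `A_{Y,μ} → A_{X,σ}`, `f ↦ (x ↦ f (φ x))`. -/
noncomputable def MultisetCat.pullback {X Y : MultisetCat.{u}} (φ : X ⟶ Y) :
    MVAlgebra.Hom Y.prodMV X.prodMV where
  toFun f x := ⟨(f (φ.toFun x)).1, MultisetCat.chain_subset φ x (f (φ.toFun x)).2⟩
  map_zero := rfl
  map_oplus _ _ := rfl
  map_neg _ := rfl

/-- The functor `ℱ : 𝕄 ⥤ ℙᵒᵖ`, with `ℱ⟨X, σ⟩ = A_{X,σ}` and `ℱ(φ)(f)(x) = f (φ x)`, given that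
the `A_{X,σ}` are profinite and that the `ℱ(φ)` reflect principal maximal ideals. -/
noncomputable def functorF
    (hprof : ∀ X : MultisetCat.{u}, IsProfiniteMV X.prodMV)
    (hrefl : ∀ (X Y : MultisetCat.{u}) (φ : X ⟶ Y),
      (MultisetCat.pullback φ).ReflectsPrincipalMaximal) :
    MultisetCat.{u} ⥤ ProfMV.{u}ᵒᵖ where
  obj X := Opposite.op ⟨X.prodMV, hprof X⟩
  map {X Y} φ := Quiver.Hom.op (V := ProfMV.{u}) ⟨MultisetCat.pullback φ, hrefl X Y φ⟩

/-! The duality rests on two facts: profinite MV-algebras are exactly the products of finite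
Łukasiewicz chains, up to isomorphism, and the factors of such a product can be recovered from its
principal maximal ideals.

Recovery of factors (`MultisetCat.exists_eq_ker_eval`): let `a` generate a maximal ideal of the
product. If `a` vanishes at a point, the ideal is the kernel of evaluation there. Otherwise `a` is
positive everywhere with infimum 0, and the functions bounded by multiples of `√a` form a proper
ideal strictly containing that of `a`, a contradiction. A finite-valued homomorphism into `[0,1]` is
determined by its kernel (`Hom.eq_of_ker_subset`), so the points of `ℋ(ℱ X)` are the evaluations,
and their ranges return the multiplicities.

Profinite implies product (`IsProfiniteMV.exists_iso_prodMV`): homomorphisms into `[0,1]` separate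
points of a finite MV-algebra, since the multiples of an atom form a chain onto which the algebra
projects (`exists_hom_ne_zero`). Evaluation at the homomorphisms factoring through a finite stage
therefore embeds the limit in a product of chains. A Chinese remainder argument
(`Hom.exists_forall_map_eq`) solves each finite stage, and uniqueness of the solutions makes them
compatible.

Finally, the unit is bijective with equal multiplicities. One triangle identity makes the counit
invertible on products, and naturality carries this to all profinite algebras. -/

namespace MVAlgebra

/-! ### The ordered monoid underlying an MV-algebra -/

section Order

variable {A : Type u} [MVAlgebra A]

theorem zero_oplus (x : A) : oplus zero x = x := by
  rw [oplus_comm, oplus_zero]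

/-- The Łukasiewicz axiom at `y = ¬0`. -/
theorem neg_oplus_self (x : A) : oplus (neg x) x = neg zero := by
  have h := luk x (neg zero)
  rw [oplus_comm _ (neg zero), neg_zero_oplus, MVAlgebra.neg_neg, zero_oplus] at h
  exact h.symm

theorem le_iff_exists_oplus {x y : A} : le x y ↔ ∃ c, y = oplus x c := by
  constructor
  · intro h
    refine ⟨neg (oplus (neg y) x), ?_⟩
    have := luk x y
    rw [show oplus (neg x) y = neg zero from h, MVAlgebra.neg_neg, zero_oplus] at this
    exact this.trans (oplus_comm _ _)
  · rintro ⟨c, rfl⟩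
    change oplus _ _ = _
    rw [← oplus_assoc, neg_oplus_self, neg_zero_oplus]

/-- The additive monoid structure `(A, ⊕, 0)`. -/
abbrev toAddCommMonoid : AddCommMonoid A where
  add := oplus
  zero := zero
  add_assoc := oplus_assoc
  zero_add := zero_oplus
  add_zero := oplus_zero
  add_comm := oplus_comm
  nsmul := @nsmulRec A ⟨zero⟩ ⟨oplus⟩

/-- The natural order of an MV-algebra. -/
abbrev toPartialOrder : PartialOrder A where
  le := le
  le_refl := neg_oplus_self
  le_trans x y z hxy hyz := by
    obtain ⟨c, rfl⟩ := le_iff_exists_oplus.1 hxy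
    obtain ⟨d, rfl⟩ := le_iff_exists_oplus.1 hyz
    exact le_iff_exists_oplus.2 ⟨_, oplus_assoc _ _ _⟩
  le_antisymm x y hxy hyx := by
    have := luk x y
    rw [show oplus (neg x) y = neg zero from hxy, show oplus (neg y) x = neg zero from hyx,
      MVAlgebra.neg_neg, zero_oplus, zero_oplus] at this
    exact this.symm

/-- The truncated difference `x ⊖ y = ¬(¬x ⊕ y)`. -/
abbrev toSub : Sub A := ⟨fun x y => neg (oplus (neg x) y)⟩

attribute [local instance] toAddCommMonoid toPartialOrder toSub

theorem canonicallyOrderedAdd : CanonicallyOrderedAdd A where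
  exists_add_of_le h := le_iff_exists_oplus.1 h
  le_add_self _ y := le_iff_exists_oplus.2 ⟨y, oplus_comm _ _⟩
  le_self_add _ y := le_iff_exists_oplus.2 ⟨y, rfl⟩

theorem isOrderedAddMonoid : IsOrderedAddMonoid A where
  add_le_add_left x y h z := by
    obtain ⟨c, rfl⟩ := le_iff_exists_oplus.1 h
    refine le_iff_exists_oplus.2 ⟨c, ?_⟩
    change x + c + z = x + z + c
    exact add_right_comm _ _ _

/-- Residuation: both inequalities unfold to `¬x ⊕ y ⊕ z = ¬0`. With it the general theory of
truncated subtraction becomes available. -/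
theorem orderedSub : OrderedSub A where
  tsub_le_iff_right x y z := by
    change oplus (neg (neg (oplus (neg x) y))) z = neg zero ↔ oplus (neg x) (oplus z y) = neg zero
    rw [MVAlgebra.neg_neg, oplus_assoc, oplus_comm y z]

attribute [local instance] canonicallyOrderedAdd isOrderedAddMonoid orderedSub

/-- The Łukasiewicz axiom read through negation; the common value is the meet of `x` and `y`. -/
theorem sub_sub_self_comm (x y : A) : x - (x - y) = y - (y - x) := by
  have h := luk (neg x) (neg y)
  rw [MVAlgebra.neg_neg, MVAlgebra.neg_neg] at h
  change neg (oplus (neg x) (neg (oplus (neg x) y))) = neg (oplus (neg y) (neg (oplus (neg y) x)))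
  rw [oplus_comm (neg x) y, oplus_comm (neg y) x, oplus_comm (neg x), oplus_comm (neg y), h]

theorem neg_sub_neg (x y : A) : neg x - neg y = y - x := by
  change neg (oplus (neg (neg x)) (neg y)) = neg (oplus (neg y) x)
  rw [MVAlgebra.neg_neg, oplus_comm]

/-! ### Atoms and the chain of their multiples -/

theorem exists_atom_le [Finite A] {b : A} (hb : b ≠ 0) :
    ∃ u : A, u ≤ b ∧ u ≠ 0 ∧ ∀ v ≤ u, v = 0 ∨ v = u := by
  obtain ⟨u, ⟨hub, hu0⟩, hmin⟩ :=
    (Set.toFinite {x : A | x ≤ b ∧ x ≠ 0}).exists_minimal ⟨b, le_rfl, hb⟩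
  refine ⟨u, hub, hu0, fun v hv => ?_⟩
  by_cases hv0 : v = 0
  · exact Or.inl hv0
  · exact Or.inr (le_antisymm hv (hmin ⟨hv.trans hub, hv0⟩ hv))

/-- The meet of `u` and `r` lies below the atom `u`, hence is `0` or `u`; the second would give `u ≤
r`. -/
theorem sub_atom_eq_self {u r : A} (hu : ∀ v ≤ u, v = 0 ∨ v = u) (h : ¬ u ≤ r) : r - u = r := by
  rcases hu (u - (u - r)) tsub_le_self with h0 | h1
  · rw [sub_sub_self_comm, tsub_eq_zero_iff_le] at h0
    exact le_antisymm tsub_le_self h0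
  · rw [sub_sub_self_comm] at h1
    exact absurd (h1 ▸ tsub_le_self) h

theorem sub_nsmul_eq_self {u r : A} (h : r - u = r) (n : ℕ) : r - n • u = r := by
  induction n with
  | zero => rw [zero_nsmul, tsub_zero]
  | succ n ih => rw [succ_nsmul, tsub_add_eq_tsub_tsub, ih, h]

/-- Every element below a multiple of an atom is a multiple of the atom. -/
theorem exists_nsmul_eq {u : A} (hu : ∀ v ≤ u, v = 0 ∨ v = u) (n : ℕ) {x : A}
    (hx : x ≤ n • u) : ∃ k ≤ n, x = k • u := by
  classical
  set k := Nat.findGreatest (fun k => k • u ≤ x) n with hk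
  have hkn : k ≤ n := Nat.findGreatest_le n
  have hkx : k • u ≤ x := Nat.findGreatest_spec (P := fun k => k • u ≤ x) (Nat.zero_le n)
    (by simp only [zero_nsmul]; exact zero_le)
  rcases hkn.lt_or_eq with hlt | heq
  -- By maximality of `k` the remainder does not dominate `u`, so subtracting any multiple of `u`
  -- leaves it unchanged; yet it lies below `n • u`, so it is zero.
  · have hr : ¬ u ≤ x - k • u := fun h => by
      have : (k + 1) • u ≤ x := by
        rw [succ_nsmul, add_comm, ← tsub_add_cancel_of_le hkx]
        gcongr
      exact Nat.findGreatest_is_greatest (P := fun k => k • u ≤ x) (Nat.lt_succ_self _) hlt this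
    have h0 : x - k • u = 0 := by
      rw [← sub_nsmul_eq_self (sub_atom_eq_self hu hr) n, tsub_eq_zero_iff_le]
      exact tsub_le_self.trans hx
    exact ⟨k, hkn, le_antisymm (tsub_eq_zero_iff_le.1 h0) hkx⟩
  · exact ⟨k, hkn, le_antisymm (heq ▸ hx) hkx⟩

theorem nsmul_eq_of_le {u : A} {n k : ℕ} (hn : n • u = (n + 1) • u) (hk : n ≤ k) :
    k • u = n • u := by
  induction k, hk using Nat.le_induction with
  | base => rfl
  | succ k _ ih => rw [succ_nsmul, ih, ← succ_nsmul, ← hn]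

/-- A coincidence `i • u = j • u` with `i < j` would squeeze `(i + 1) • u` onto `i • u`, against the
choice of `n`. -/
theorem nsmul_inj_of_le {u : A} {n i j : ℕ} (hmin : ∀ m < n, m • u ≠ (m + 1) • u)
    (hi : i ≤ n) (hj : j ≤ n) (h : i • u = j • u) : i = j := by
  wlog hij : i ≤ j generalizing i j
  · exact (this hj hi h.symm (le_of_not_ge hij)).symm
  by_contra hne
  have hlt : i < j := lt_of_le_of_ne hij hne
  refine hmin i (by omega) (le_antisymm (nsmul_le_nsmul_left zero_le (Nat.le_succ i)) ?_)
  rw [h]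
  exact nsmul_le_nsmul_left zero_le hlt

theorem exists_nsmul_eq_succ [Finite A] (u : A) : ∃ n : ℕ, n • u = (n + 1) • u := by
  obtain ⟨i, j, hij, h⟩ := Finite.exists_ne_map_eq_of_infinite fun n : ℕ => n • u
  wlog hlt : i < j generalizing i j
  · exact this j i hij.symm h.symm (by omega)
  refine ⟨i, le_antisymm (nsmul_le_nsmul_left zero_le (Nat.le_succ i)) ?_⟩
  exact (nsmul_le_nsmul_left zero_le hlt).trans h.ge

theorem nsmul_sub_nsmul {u : A} (hu : ∀ v ≤ u, v = 0 ∨ v = u) {n : ℕ}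
    (hn : n • u = (n + 1) • u) (hmin : ∀ m < n, m • u ≠ (m + 1) • u) (k : ℕ) :
    n • u - k • u = (n - k) • u := by
  rcases le_total n k with h | h
  · rw [nsmul_eq_of_le hn h, tsub_self, Nat.sub_eq_zero_of_le h, zero_nsmul]
  obtain ⟨j, hj, hje⟩ := exists_nsmul_eq hu n (tsub_le_self : n • u - k • u ≤ n • u)
  apply le_antisymm
  · rw [tsub_le_iff_right, ← add_nsmul, Nat.sub_add_cancel h]
  · rw [hje]
    refine nsmul_le_nsmul_left zero_le ?_
    have h1 : (j + k) • u = n • u := by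
      rw [add_nsmul, ← hje, tsub_add_cancel_of_le (nsmul_le_nsmul_left zero_le h)]
    by_contra hlt
    have := nsmul_inj_of_le hmin (by omega : j + k ≤ n) le_rfl h1
    omega

/-- Only the part of `x` below `e`, the meet `e - (e - x)`, matters when subtracting from `e`. -/
theorem sub_eq_sub_sub_sub (e x : A) : e - x = e - (e - (e - x)) := by
  rw [sub_sub_self_comm e (e - x), tsub_eq_zero_of_le (tsub_le_self : e - x ≤ e), tsub_zero]

/-- An idempotent `e` is disjoint from its complement, so meeting with `e` turns negation into the
complement relative to `e`. -/
theorem sub_sub_eq_sub_neg {e : A} (he : e + e = e) (x : A) :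
    e - (e - x) = e - neg x := by
  apply le_antisymm
  · have h1 : neg e - e = neg e := by
      change neg (oplus (neg (neg e)) e) = neg e
      rw [MVAlgebra.neg_neg]
      exact congrArg neg he
    have h2 : e ≤ e - neg e := by
      rw [← tsub_eq_zero_iff_le, sub_sub_self_comm, h1, tsub_self]
    rw [tsub_le_iff_right]
    calc e ≤ e - neg e := h2
      _ ≤ (e - neg x) + (neg x - neg e) := tsub_le_tsub_add_tsub
      _ = _ := by rw [neg_sub_neg]
  · refine tsub_le_tsub_left ?_ e
    rw [tsub_le_iff_right]
    change le e (oplus (neg x) x)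
    rw [neg_oplus_self]
    change oplus _ _ = _
    rw [oplus_comm, neg_zero_oplus]

/-- The homomorphisms into `[0,1]` separate the points of a finite MV-algebra from zero. -/
theorem exists_hom_ne_zero [Finite A] {b : A} (hb : b ≠ zero) :
    ∃ χ : Hom A unitInterval, χ b ≠ zero := by
  classical
  obtain ⟨u, hub, hu0, hu⟩ := exists_atom_le (b := b) hb
  have hex := exists_nsmul_eq_succ u
  obtain ⟨n, hn, hmin⟩ : ∃ n : ℕ, n • u = (n + 1) • u ∧ ∀ m < n, m • u ≠ (m + 1) • u :=
    ⟨Nat.find hex, Nat.find_spec hex, fun _ h => Nat.find_min hex h⟩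
  have hn0 : 0 < n := Nat.pos_of_ne_zero (by
    rintro rfl
    rw [zero_nsmul, zero_add, one_nsmul] at hn
    exact hu0 hn.symm)
  have hn0' : (0 : ℝ) < n := by exact_mod_cast hn0
  have he : n • u + n • u = n • u := by
    rw [← add_nsmul]; exact nsmul_eq_of_le hn (by omega)
  -- The idempotent `e = n • u` bounds a chain of `n + 1` multiples of `u`. Here `j x` counts what
  -- `x` misses of `e`, so the meet of `e` and `x` is `(n - j x) • u` and the homomorphism is `x ↦
  -- (n - j x) / n`.
  choose j hjn hj using fun x : A => exists_nsmul_eq hu n (tsub_le_self : n • u - x ≤ n • u)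
  have key : ∀ {x : A} {k : ℕ}, k ≤ n → n • u - x = k • u → j x = k := fun {x k} hk h =>
    nsmul_inj_of_le hmin (hjn x) hk ((hj x).symm.trans h)
  have hm : ∀ x : A, n • u - (n • u - x) = (n - j x) • u := fun x => by
    rw [hj x, nsmul_sub_nsmul hu hn hmin]
  have hzero : j 0 = n := key le_rfl (tsub_zero _)
  have hadd : ∀ x y : A, j (x + y) = n - ((n - j x) + (n - j y)) := fun x y => by
    refine key (Nat.sub_le _ _) ?_
    rw [tsub_add_eq_tsub_tsub, sub_eq_sub_sub_sub _ x, tsub_right_comm, sub_eq_sub_sub_sub _ y,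
      tsub_right_comm, ← tsub_add_eq_tsub_tsub, hm, hm, ← add_nsmul, nsmul_sub_nsmul hu hn hmin]
  have hneg : ∀ x : A, j (neg x) = n - j x := fun x => by
    refine key (Nat.sub_le _ _) ?_
    rw [← sub_sub_eq_sub_neg he, hm]
  refine ⟨⟨fun x => ⟨((n - j x : ℕ) : ℝ) / n, by positivity, ?_⟩, ?_, ?_, ?_⟩, ?_⟩
  · rw [div_le_one hn0']
    exact_mod_cast Nat.sub_le _ _
  · apply Subtype.ext
    change ((n - j 0 : ℕ) : ℝ) / n = 0
    simp [hzero]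
  · intro x y
    apply Subtype.ext
    change ((n - j (x + y) : ℕ) : ℝ) / n =
      min (((n - j x : ℕ) : ℝ) / n + ((n - j y : ℕ) : ℝ) / n) 1
    rw [hadd, ← add_div, ← div_self hn0'.ne', min_div_div_right hn0'.le]
    congr 1
    rw [← Nat.cast_add, ← Nat.cast_min]
    congr 1
    omega
  · intro x
    apply Subtype.ext
    change ((n - j (neg x) : ℕ) : ℝ) / n = 1 - ((n - j x : ℕ) : ℝ) / n
    rw [hneg, eq_sub_iff_add_eq, ← add_div, ← Nat.cast_add, div_eq_one_iff_eq hn0'.ne']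
    have := hjn x
    congr 1
    omega
  · intro h
    have h' : ((n - j b : ℕ) : ℝ) / n = 0 := congrArg Subtype.val h
    rw [div_eq_zero_iff, or_iff_left hn0'.ne', Nat.cast_eq_zero] at h'
    have h1 : j b = n := by have := hjn b; omega
    -- Value zero at `b` means `e - b = e`, but `u ≤ b` forces `e - b ≤ e - u = (n - 1) • u`.
    have h2 : n • u ≤ (n - 1) • u := by
      rw [← h1, ← hj b, h1, ← nsmul_sub_nsmul hu hn hmin 1, one_nsmul]
      exact tsub_le_tsub_left hub _
    have h3 := nsmul_inj_of_le hmin (Nat.sub_le n 1) le_rfl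
      (le_antisymm (nsmul_le_nsmul_left zero_le (Nat.sub_le n 1)) h2)
    omega

end Order

end MVAlgebra

namespace MVAlgebra

/-! ### Homomorphisms into `[0,1]` with finite range -/

section FiniteRange

variable {A : Type u} {B : Type v} [MVAlgebra A] [MVAlgebra B]

/-- The Łukasiewicz product `x ⊙ y = ¬(¬x ⊕ ¬y)`. -/
def odot (x y : A) : A := neg (oplus (neg x) (neg y))

/-- The truncated difference `x ⊖ y = ¬(¬x ⊕ y)`. -/
def diff (x y : A) : A := neg (oplus (neg x) y)

/-- The multiple `x ⊕ ⋯ ⊕ x`. -/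
def times : ℕ → A → A
  | 0, _ => zero
  | n + 1, x => oplus (times n x) x

theorem coe_zero : ((zero : unitInterval) : ℝ) = 0 := rfl

theorem coe_neg (x : unitInterval) : ((neg x : unitInterval) : ℝ) = 1 - x := rfl

theorem coe_oplus (x y : unitInterval) : ((oplus x y : unitInterval) : ℝ) = min ((x : ℝ) + y) 1 :=
  rfl

theorem coe_odot (x y : unitInterval) :
    ((odot x y : unitInterval) : ℝ) = max ((x : ℝ) + y - 1) 0 := by
  rw [odot, coe_neg, coe_oplus, coe_neg, coe_neg, min_def, max_def]
  split_ifs <;> linarith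

theorem coe_diff (x y : unitInterval) :
    ((diff x y : unitInterval) : ℝ) = max ((x : ℝ) - y) 0 := by
  rw [diff, coe_neg, coe_oplus, coe_neg, min_def, max_def]
  split_ifs <;> linarith

theorem coe_times (n : ℕ) (x : unitInterval) :
    ((times n x : unitInterval) : ℝ) = min (n * (x : ℝ)) 1 := by
  induction n with
  | zero => simp [times, coe_zero]
  | succ n ih =>
    have := x.2.1
    rw [times, coe_oplus, ih]
    push_cast
    simp only [min_def]
    split_ifs <;> linarith

theorem Hom.map_odot (f : Hom A B) (x y : A) : f (odot x y) = odot (f x) (f y) := by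
  simp only [odot, f.map_neg, f.map_oplus]

theorem Hom.map_diff (f : Hom A B) (x y : A) : f (diff x y) = diff (f x) (f y) := by
  simp only [diff, f.map_neg, f.map_oplus]

theorem Hom.map_times (f : Hom A B) (n : ℕ) (x : A) : f (times n x) = times n (f x) := by
  induction n with
  | zero => exact f.map_zero
  | succ n ih => rw [times, f.map_oplus, ih, times]

theorem le_iff_coe_le {x y : unitInterval} : le x y ↔ (x : ℝ) ≤ y := by
  have h : le x y ↔ ((oplus (neg x) y : unitInterval) : ℝ) = ((neg zero : unitInterval) : ℝ) :=
    Subtype.ext_iff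
  rw [h, coe_oplus, coe_neg, coe_neg, coe_zero, sub_zero, min_eq_right_iff]
  constructor <;> intro h <;> linarith

theorem Hom.le_map (f : Hom A B) {x y : A} (h : le x y) : le (f x) (f y) := by
  change oplus _ _ = _
  rw [← f.map_neg, ← f.map_oplus, show oplus (neg x) y = neg zero from h, f.map_neg, f.map_zero]

/-- A finite-valued homomorphism into `[0,1]` takes the values `0, 1/m, …, 1` for some `m > 0`. -/
theorem Hom.range_eq_lukChain (χ : Hom A unitInterval) (h : (Set.range χ).Finite) :
    ∃ (m : ℕ) (hm : 0 < m),
      Set.range χ = (lukChain (m + 1) (Nat.succ_le_succ hm)).carrier := by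
  have hone : ((χ (neg zero) : unitInterval) : ℝ) = 1 := by
    rw [χ.map_neg, χ.map_zero, coe_neg, coe_zero, sub_zero]
  -- The least positive value `χ a` divides every value: the remainder of `χ x` is again a value,
  -- smaller than `χ a`, hence zero. Since `1` is a value, `χ a = 1 / m`.
  obtain ⟨_, ⟨⟨a, rfl⟩, ha0⟩, hmin⟩ :=
    (h.inter_of_left {t | (0 : ℝ) < t}).exists_minimal ⟨χ (neg zero), ⟨_, rfl⟩, by
      change (0 : ℝ) < χ (neg zero)
      rw [hone]
      exact one_pos⟩
  replace ha0 : (0 : ℝ) < χ a := ha0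
  have hmin' : ∀ x, (0 : ℝ) < χ x → (χ a : ℝ) ≤ χ x := fun x hx => by
    by_contra! hlt
    exact hlt.not_ge (hmin ⟨⟨x, rfl⟩, hx⟩ hlt.le)
  have hmul : ∀ x, ∃ k : ℕ, (χ x : ℝ) = k * χ a := fun x => by
    refine ⟨⌊(χ x : ℝ) / χ a⌋₊, ?_⟩
    have h1 : ⌊(χ x : ℝ) / χ a⌋₊ * (χ a : ℝ) ≤ χ x :=
      (le_div_iff₀ ha0).1 (Nat.floor_le (div_nonneg (χ x).2.1 ha0.le))
    have h2 : (χ x : ℝ) < (⌊(χ x : ℝ) / χ a⌋₊ + 1) * (χ a : ℝ) :=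
      (div_lt_iff₀ ha0).1 (Nat.lt_floor_add_one _)
    set k := ⌊(χ x : ℝ) / χ a⌋₊
    have h3 : (χ (diff x (times k a)) : ℝ) = χ x - k * χ a := by
      rw [χ.map_diff, χ.map_times, coe_diff, coe_times, min_eq_left (h1.trans (χ x).2.2),
        max_eq_left (by linarith)]
    by_contra hne
    have h4 := hmin' (diff x (times k a)) (by
      rw [h3]; exact sub_pos.2 (lt_of_le_of_ne h1 (Ne.symm hne)))
    rw [h3] at h4
    linarith
  obtain ⟨m, hm⟩ := hmul (neg zero)
  rw [hone] at hm
  have hm0 : 0 < m := Nat.pos_of_ne_zero (by rintro rfl; simp at hm)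
  have hm0' : (0 : ℝ) < m := by exact_mod_cast hm0
  have ha : (χ a : ℝ) = 1 / m := by rw [eq_div_iff hm0'.ne', mul_comm]; exact hm.symm
  refine ⟨m, hm0, Set.Subset.antisymm ?_ ?_⟩
  · rintro _ ⟨x, rfl⟩
    obtain ⟨k, hk⟩ := hmul x
    rw [ha, mul_one_div] at hk
    refine ⟨k, ?_, by rw [hk]; push_cast; rw [add_sub_cancel_right]⟩
    have := (χ x).2.2
    rw [hk, div_le_one hm0'] at this
    exact Nat.lt_succ_of_le (by exact_mod_cast this)
  · rintro t ⟨k, hk, ht⟩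
    refine ⟨times k a, Subtype.ext ?_⟩
    push_cast at ht
    rw [χ.map_times, coe_times, ha, mul_one_div, ht, add_sub_cancel_right, min_eq_left]
    rw [div_le_one hm0']
    exact_mod_cast Nat.le_of_lt_succ hk

theorem ncard_lukChain (n : ℕ) (hn : 2 ≤ n) : (lukChain n hn).carrier.ncard = n := by
  have hn' : (0 : ℝ) < (n : ℝ) - 1 := by
    have : (2 : ℝ) ≤ n := by exact_mod_cast hn
    linarith
  have hle : ∀ k < n, (k : ℝ) / ((n : ℝ) - 1) ≤ 1 := fun k hk => by
    rw [div_le_one hn', le_sub_iff_add_le]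
    exact_mod_cast hk
  have : Nat.card (lukChain n hn).carrier = Nat.card (Fin n) := by
    refine (Nat.card_eq_of_bijective
      (fun k : Fin n => (⟨⟨(k : ℝ) / ((n : ℝ) - 1), div_nonneg (Nat.cast_nonneg _) hn'.le,
        hle k k.2⟩, k, k.2, rfl⟩ : (lukChain n hn).carrier)) ⟨fun i j h => ?_, ?_⟩).symm
    · have h' : (i : ℝ) / ((n : ℝ) - 1) = j / ((n : ℝ) - 1) :=
        congrArg (fun t : (lukChain n hn).carrier => ((t : unitInterval) : ℝ)) h
      rw [div_left_inj' hn'.ne'] at h'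
      exact Fin.ext (by exact_mod_cast h')
    · rintro ⟨t, k, hk, ht⟩
      exact ⟨⟨k, hk⟩, Subtype.ext (Subtype.ext ht.symm)⟩
  rw [← Nat.card_coe_set_eq, this, Nat.card_fin]

theorem finite_lukChain (n : ℕ) (hn : 2 ≤ n) : (lukChain n hn).carrier.Finite :=
  Set.finite_of_ncard_pos (by rw [ncard_lukChain]; omega)

/-- The element `1 / m` must equal some `k / n`. -/
theorem dvd_of_lukChain_subset {m n : ℕ} (hm : 0 < m) (hn : 0 < n)
    (h : (lukChain (m + 1) (Nat.succ_le_succ hm)).carrier ⊆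
      (lukChain (n + 1) (Nat.succ_le_succ hn)).carrier) : m ∣ n := by
  have hm' : (0 : ℝ) < m := by exact_mod_cast hm
  have hn' : (0 : ℝ) < n := by exact_mod_cast hn
  have h1 : (1 : ℝ) ≤ m := by exact_mod_cast hm
  obtain ⟨k, -, hk⟩ := h (a := ⟨1 / m, by positivity, (div_le_one hm').2 h1⟩)
    ⟨1, by omega, by push_cast; rw [add_sub_cancel_right]⟩
  push_cast at hk
  rw [add_sub_cancel_right, div_eq_div_iff hm'.ne' hn'.ne', one_mul] at hk
  exact ⟨k, by rw [mul_comm]; exact_mod_cast hk⟩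

/-- Equality of two values means that both truncated differences lie in the kernel. -/
theorem Hom.map_eq_of_map_eq {f : Hom A unitInterval} {g : Hom A unitInterval}
    (h : f.ker ⊆ g.ker) {x y : A} (hxy : f x = f y) : g x = g y := by
  have key : ∀ {x y : A}, f x = f y → (g x : ℝ) ≤ g y := fun {x y} hxy => by
    have h1 : diff x y ∈ f.ker := by
      change f _ = _
      apply Subtype.ext
      rw [f.map_diff, hxy, coe_diff, sub_self, max_self, coe_zero]
    have h2 : (g (diff x y) : ℝ) = 0 := congrArg Subtype.val (h h1)
    rw [g.map_diff, coe_diff] at h2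
    linarith [le_max_left ((g x : ℝ) - g y) 0]
  exact Subtype.ext (le_antisymm (key hxy) (key hxy.symm))

/-- A finite-valued homomorphism into `[0,1]` is determined by its kernel. -/
theorem Hom.eq_of_ker_subset {χ ψ : Hom A unitInterval} (hχ : (Set.range χ).Finite)
    (h : χ.ker ⊆ ψ.ker) : χ = ψ := by
  obtain ⟨m, hm, hr⟩ := χ.range_eq_lukChain hχ
  have hm' : (0 : ℝ) < m := by exact_mod_cast hm
  have h1 : (1 : ℝ) ≤ m := by exact_mod_cast hm
  obtain ⟨a, ha⟩ : (⟨1 / m, by positivity, (div_le_one hm').2 h1⟩ : unitInterval) ∈ Set.range χ := by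
    rw [hr]
    exact ⟨1, by omega, by push_cast; rw [add_sub_cancel_right]⟩
  have ha' : (χ a : ℝ) = 1 / m := congrArg Subtype.val ha
  have hmul : ∀ k ≤ m, (χ (times k a) : ℝ) = k / m := fun k hk => by
    rw [χ.map_times, coe_times, ha', mul_one_div, min_eq_left]
    rw [div_le_one hm']
    exact_mod_cast hk
  -- The relations `¬a = (m - 1)a` and `ma = 1` hold under `χ`, hence under `ψ`, and `1 / m` is
  -- their only solution in `[0,1]`; the second relation excludes `ψ a = 0`.
  have hψa : (ψ a : ℝ) = 1 / m := by
    have e1 : χ (neg a) = χ (times (m - 1) a) := by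
      apply Subtype.ext
      rw [hmul _ (Nat.sub_le _ _), χ.map_neg, coe_neg, ha', Nat.cast_sub hm, Nat.cast_one, sub_div,
        div_self hm'.ne']
    have e2 := congrArg Subtype.val (Hom.map_eq_of_map_eq h e1)
    rw [ψ.map_neg, ψ.map_times, coe_neg, coe_times, Nat.cast_sub hm, Nat.cast_one] at e2
    have e3 : χ (neg zero) = χ (times m a) := by
      apply Subtype.ext
      rw [hmul _ le_rfl, χ.map_neg, χ.map_zero, coe_neg, coe_zero, sub_zero, div_self hm'.ne']
    have e4 := congrArg Subtype.val (Hom.map_eq_of_map_eq h e3)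
    rw [ψ.map_neg, ψ.map_zero, ψ.map_times, coe_neg, coe_zero, coe_times, sub_zero] at e4
    have e5 : (1 : ℝ) ≤ m * ψ a := e4 ▸ min_le_left _ _
    have e6 : (ψ a : ℝ) ≠ 0 := fun h0 => by rw [h0] at e5; linarith
    rw [eq_div_iff hm'.ne']
    rcases min_choice (((m : ℝ) - 1) * (ψ a : ℝ)) 1 with h7 | h7 <;> rw [h7] at e2
    · linarith
    · exact absurd (by linarith) e6
  have key : ∀ x, (χ x : ℝ) = ψ x := fun x => by
    obtain ⟨k, hk, hx⟩ : χ x ∈ (lukChain (m + 1) (Nat.succ_le_succ hm)).carrier := hr ▸ ⟨x, rfl⟩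
    push_cast at hx
    rw [add_sub_cancel_right] at hx
    have hk' := Nat.le_of_lt_succ hk
    have e1 : χ x = χ (times k a) := Subtype.ext (hx.trans (hmul k hk').symm)
    rw [Hom.map_eq_of_map_eq h e1, e1, χ.map_times, ψ.map_times, coe_times, coe_times, ha', hψa]
  exact Hom.ext (funext fun x => Subtype.ext (key x))

theorem Hom.exists_map_eq_one_map_eq_zero {χ ψ : Hom A unitInterval} (hχ : (Set.range χ).Finite)
    (h : χ ≠ ψ) : ∃ a, (χ a : ℝ) = 0 ∧ (ψ a : ℝ) = 1 := by
  obtain ⟨a, ha, hb⟩ := Set.not_subset.1 fun hs => h (Hom.eq_of_ker_subset hχ hs)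
  have ha' : (χ a : ℝ) = 0 := congrArg Subtype.val ha
  have hb' : (0 : ℝ) < ψ a := lt_of_le_of_ne (ψ a).2.1 fun h0 => hb (Subtype.ext h0.symm)
  obtain ⟨n, hn⟩ := exists_nat_ge (1 / (ψ a : ℝ))
  rw [div_le_iff₀ hb'] at hn
  refine ⟨times n a, ?_, ?_⟩
  · rw [χ.map_times, coe_times, ha', mul_zero, min_eq_left zero_le_one]
  · rw [ψ.map_times, coe_times, min_eq_right hn]

/-- Chinese remainder theorem: finitely many finite-valued homomorphisms into `[0,1]` can be
prescribed independently. -/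
theorem Hom.exists_forall_map_eq (S : Finset (Hom A unitInterval))
    (hS : ∀ χ ∈ S, (Set.range χ).Finite) (d : Hom A unitInterval → A) :
    ∃ a, ∀ χ ∈ S, χ a = χ (d χ) := by
  classical
  have hsep : ∀ (ψ : Hom A unitInterval) (S : Finset (Hom A unitInterval)),
      (∀ χ ∈ S, (Set.range χ).Finite) → ψ ∉ S →
        ∃ e, (ψ e : ℝ) = 1 ∧ ∀ χ ∈ S, (χ e : ℝ) = 0 := by
    intro ψ S
    induction S using Finset.induction_on with
    | empty =>
      exact fun _ _ => ⟨neg zero, by rw [ψ.map_neg, ψ.map_zero, coe_neg, coe_zero, sub_zero],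
        by simp⟩
    | insert χ S _ ih =>
      intro hS hψ
      rw [Finset.mem_insert, not_or] at hψ
      obtain ⟨e, he, heS⟩ := ih (fun χ h => hS χ (Finset.mem_insert_of_mem h)) hψ.2
      obtain ⟨a, ha, ha'⟩ := Hom.exists_map_eq_one_map_eq_zero
        (hS χ (Finset.mem_insert_self _ _)) (Ne.symm hψ.1)
      refine ⟨odot e a, ?_, fun φ hφ => ?_⟩
      · rw [ψ.map_odot, coe_odot, he, ha']; norm_num
      · rw [φ.map_odot, coe_odot]
        apply max_eq_right
        rcases Finset.mem_insert.1 hφ with rfl | hφ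
        · linarith [(φ e).2.2]
        · linarith [(φ a).2.2, heS φ hφ]
  induction S using Finset.induction_on with
  | empty => exact ⟨zero, by simp⟩
  | insert ψ S hψ ih =>
    have hS' : ∀ χ ∈ S, (Set.range χ).Finite := fun χ h => hS χ (Finset.mem_insert_of_mem h)
    obtain ⟨a, ha⟩ := ih hS'
    obtain ⟨e, he, heS⟩ := hsep ψ S hS' hψ
    -- The element `e` acts as a switch: where it is `1` it selects `d ψ`, where it is `0` it
    -- selects `a`.
    refine ⟨oplus (odot e (d ψ)) (odot (neg e) a), fun χ hχ => Subtype.ext ?_⟩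
    rw [χ.map_oplus, χ.map_odot, χ.map_odot, χ.map_neg, coe_oplus, coe_odot, coe_odot, coe_neg]
    rcases Finset.mem_insert.1 hχ with rfl | hχ
    · have h1 := (χ a).2
      have h2 := (χ (d χ)).2
      rw [he, max_eq_left (by linarith [h2.1]), max_eq_right (by linarith [h1.2]),
        min_eq_left (by linarith [h2.2])]
      ring
    · rw [heS χ hχ, ha χ hχ]
      have h1 := (χ (d χ)).2
      have h2 := (χ (d ψ)).2
      rw [max_eq_right (by linarith [h2.2]), max_eq_left (by linarith [h1.1]),
        min_eq_left (by linarith [h1.2])]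
      ring

/-- Each range is a chain with at most `Nat.card A` elements, so all values lie in one finite set.
-/
theorem finite_hom_unitInterval [Finite A] : Finite (Hom A unitInterval) := by
  let T : Set unitInterval :=
    ⋃ n : Fin (Nat.card A + 1), ⋃ h : 2 ≤ (n : ℕ), (lukChain n h).carrier
  have hT : T.Finite :=
    Set.finite_iUnion fun n => Set.finite_iUnion fun h => finite_lukChain n h
  have hmem : ∀ (χ : Hom A unitInterval) a, χ a ∈ T := fun χ a => by
    obtain ⟨m, hm, hr⟩ := χ.range_eq_lukChain (Set.toFinite _)
    have hc : m + 1 ≤ Nat.card A := by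
      rw [← ncard_lukChain (m + 1) (Nat.succ_le_succ hm), ← hr, ← Set.image_univ,
        ← Set.ncard_univ]
      exact Set.ncard_image_le
    refine Set.mem_iUnion.2 ⟨⟨m + 1, by omega⟩, Set.mem_iUnion.2 ⟨Nat.succ_le_succ hm, ?_⟩⟩
    exact hr ▸ ⟨a, rfl⟩
  have := hT.to_subtype
  refine Finite.of_injective (fun (χ : Hom A unitInterval) (a : A) => (⟨χ a, hmem χ a⟩ : T))
    fun χ ψ h => Hom.ext (funext fun a => ?_)
  exact congrArg Subtype.val (congrFun h a)

/-- The homomorphisms into `[0,1]` separate the points of a finite MV-algebra. -/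
theorem eq_of_forall_hom_eq [Finite A] {x y : A} (h : ∀ χ : Hom A unitInterval, χ x = χ y) :
    x = y := by
  have key : ∀ {x y : A}, (∀ χ : Hom A unitInterval, χ x = χ y) → le x y := fun {x y} h => by
    have h0 : diff x y = zero := by
      by_contra hne
      obtain ⟨χ, hχ⟩ := exists_hom_ne_zero hne
      refine hχ (Subtype.ext ?_)
      rw [χ.map_diff, h, coe_diff, sub_self, max_self, coe_zero]
    change oplus _ _ = _
    rw [← MVAlgebra.neg_neg (oplus (neg x) y)]
    exact congrArg neg h0
  exact toPartialOrder.le_antisymm _ _ (key h) (key fun χ => (h χ).symm)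

end FiniteRange

end MVAlgebra

namespace MVAlgebra

/-! ### Ideals -/

section Ideals

variable {A : Type u} {B : Type v} [MVAlgebra A] [MVAlgebra B]

theorem le_neg_zero (x : A) : le x (neg zero) := by
  change oplus _ _ = _
  rw [oplus_comm, neg_zero_oplus]

theorem IsIdeal.zero_mem {I : Set A} (hI : IsIdeal I) : zero ∈ I :=
  let ⟨y, hy⟩ := hI.nonempty
  hI.mem_of_le _ y hy (neg_zero_oplus y)

theorem IsIdeal.times_mem {I : Set A} (hI : IsIdeal I) {a : A} (ha : a ∈ I) (n : ℕ) :
    times n a ∈ I := by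
  induction n with
  | zero => exact hI.zero_mem
  | succ n ih => exact hI.oplus_mem _ ih _ ha

theorem IsIdeal.eq_univ {I : Set A} (hI : IsIdeal I) (h : neg zero ∈ I) : I = Set.univ :=
  Set.eq_univ_of_forall fun x => hI.mem_of_le x _ h (le_neg_zero x)

theorem IsIdeal.idealSpan_subset {I : Set A} (hI : IsIdeal I) {a : A} (ha : a ∈ I) :
    idealSpan a ⊆ I := fun _ hx => hx I hI ha

theorem mem_idealSpan_self (a : A) : a ∈ idealSpan a := fun _ _ h => h

theorem IsIdeal.preimage {I : Set B} (hI : IsIdeal I) (f : Hom A B) : IsIdeal (f ⁻¹' I) where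
  nonempty := ⟨zero, by rw [Set.mem_preimage, f.map_zero]; exact hI.zero_mem⟩
  oplus_mem x hx y hy := by
    rw [Set.mem_preimage, f.map_oplus]
    exact hI.oplus_mem _ hx _ hy
  mem_of_le x y hy h := hI.mem_of_le _ _ hy (f.le_map h)

theorem reflectsPrincipalMaximal_of_inverse (f : Hom A B) (g : Hom B A)
    (hgf : ∀ a, g (f a) = a) (hfg : ∀ b, f (g b) = b) : f.ReflectsPrincipalMaximal := by
  have hpre : ∀ {I : Set A}, f ⁻¹' (g ⁻¹' I) = I := fun {I} => by
    ext a
    rw [Set.mem_preimage, Set.mem_preimage, hgf]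
  have hpre' : ∀ {I : Set B}, g ⁻¹' (f ⁻¹' I) = I := fun {I} => by
    ext a
    rw [Set.mem_preimage, Set.mem_preimage, hfg]
  rintro M ⟨hM, b, hb⟩
  refine ⟨⟨hM.isIdeal.preimage f, fun h => hM.ne_univ ?_, fun J hJ hJ' hMJ => ?_⟩, g b,
    Set.Subset.antisymm (fun x hx J hJ hJb => ?_) ?_⟩
  · rw [← hpre' (I := M), h, Set.preimage_univ]
  · rw [← hpre (I := J)]
    congr 1
    refine hM.eq_of_subset _ (hJ.preimage g) (fun h => hJ' ?_) ?_
    · rw [← hpre (I := J), h, Set.preimage_univ]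
    · rw [← hpre' (I := M)]
      exact Set.preimage_mono hMJ
  · rw [Set.mem_preimage, hb] at hx
    rw [← hgf x]
    exact hx _ (hJ.preimage g) hJb
  · refine (hM.isIdeal.preimage f).idealSpan_subset ?_
    rw [Set.mem_preimage, hfg, hb]
    exact mem_idealSpan_self b

theorem Hom.isIdeal_ker (χ : Hom A unitInterval) : IsIdeal χ.ker where
  nonempty := ⟨zero, χ.map_zero⟩
  oplus_mem x hx y hy := by
    change χ _ = _
    rw [χ.map_oplus, show χ x = zero from hx, show χ y = zero from hy, oplus_zero]
  mem_of_le x y hy h := by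
    have h1 := le_iff_coe_le.1 (χ.le_map h)
    rw [show χ y = zero from hy, coe_zero] at h1
    exact Subtype.ext (le_antisymm h1 (χ x).2.1)

/-- If `χ a > 0`, some multiple of `a` has value `1`, so its negation is in the kernel; an ideal
containing both contains `¬0`. -/
theorem Hom.isMaximalIdeal_ker (χ : Hom A unitInterval) : IsMaximalIdeal χ.ker where
  isIdeal := χ.isIdeal_ker
  ne_univ h := by
    have h1 : χ (neg zero) = zero := Set.eq_univ_iff_forall.1 h (neg zero)
    have h2 := congrArg Subtype.val h1
    rw [χ.map_neg, χ.map_zero, coe_neg, coe_zero] at h2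
    norm_num at h2
  eq_of_subset J hJ hJ' hsub := by
    refine Set.Subset.antisymm hsub fun a ha => ?_
    by_contra hne
    have hpos : (0 : ℝ) < χ a := lt_of_le_of_ne (χ a).2.1 fun h0 => hne (Subtype.ext h0.symm)
    obtain ⟨n, hn⟩ := exists_nat_ge (1 / (χ a : ℝ))
    rw [div_le_iff₀ hpos] at hn
    have h1 : neg (times n a) ∈ J := hsub (by
      change χ _ = _
      apply Subtype.ext
      rw [χ.map_neg, χ.map_times, coe_neg, coe_times, min_eq_right hn, sub_self, coe_zero])
    refine hJ' (hJ.eq_univ ?_)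
    rw [← neg_oplus_self (times n a)]
    exact hJ.oplus_mem _ h1 _ (hJ.times_mem ha n)

end Ideals

end MVAlgebra

/-! ### Principal maximal ideals of products of chains -/

namespace MultisetCat

variable (X : MultisetCat.{u})

/-- The evaluation `f ↦ f x`. -/
noncomputable def eval (x : X) : MVAlgebra.Hom (∀ x : X, X.chain x) unitInterval where
  toFun f := (f x).1
  map_zero := rfl
  map_oplus _ _ := rfl
  map_neg _ := rfl

variable {X}

theorem le_iff {f g : ∀ x : X, X.chain x} : le f g ↔ ∀ x, (X.eval x f : ℝ) ≤ X.eval x g := by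
  constructor
  · exact fun h x => le_iff_coe_le.1 ((X.eval x).le_map h)
  · exact fun h => funext fun x => Subtype.ext (le_iff_coe_le.2 (h x))

theorem range_eval (x : X) : Set.range (X.eval x) = (X.chain x).carrier := by
  classical
  refine Set.Subset.antisymm ?_ fun t ht => ?_
  · rintro _ ⟨f, rfl⟩
    exact (f x).2
  · let f : ∀ y : X, X.chain y := Function.update zero x ⟨t, ht⟩
    have hf : f x = ⟨t, ht⟩ := Function.update_self x _ _
    exact ⟨f, congrArg Subtype.val hf⟩

theorem finite_range_eval (x : X) : (Set.range (X.eval x)).Finite := by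
  rw [range_eval]
  exact finite_lukChain _ _

open Classical in
/-- The function that is `0` at `x` and `1` elsewhere. -/
noncomputable def coatom (x : X) : ∀ y : X, X.chain y := Function.update (neg zero) x zero

open Classical in
theorem eval_coatom_self (x : X) : X.eval x (coatom x) = zero := by
  change (coatom x x).1 = zero
  rw [coatom, Function.update_self]
  rfl

open Classical in
theorem eval_coatom_of_ne {x y : X} (h : y ≠ x) : (X.eval y (coatom x) : ℝ) = 1 := by
  change ((coatom x y).1 : ℝ) = 1
  rw [coatom, Function.update_of_ne h]
  exact sub_zero 1

theorem isPrincipalMaximal_ker_eval (x : X) : IsPrincipalMaximal (X.eval x).ker := by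
  refine ⟨(X.eval x).isMaximalIdeal_ker, coatom x, Set.Subset.antisymm ?_ ?_⟩
  · intro f hf J hJ hJx
    refine hJ.mem_of_le f _ hJx (le_iff.2 fun y => ?_)
    by_cases h : y = x
    · subst h
      rw [show X.eval y f = zero from hf, coe_zero]
      exact (X.eval y (coatom y)).2.1
    · rw [eval_coatom_of_ne h]
      exact (X.eval y f).2.2
  · exact (X.eval x).isIdeal_ker.idealSpan_subset (eval_coatom_self x)

/-- The functions dominated by a multiple of `g` form an ideal. -/
theorem isIdeal_dominated (g : X → ℝ) :
    IsIdeal {f : ∀ x : X, X.chain x | ∃ k : ℕ, ∀ x, (X.eval x f : ℝ) ≤ k * g x} where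
  nonempty := ⟨zero, 0, fun x => by rw [(X.eval x).map_zero, coe_zero]; simp⟩
  oplus_mem := by
    rintro f ⟨k, hk⟩ f' ⟨l, hl⟩
    refine ⟨k + l, fun x => ?_⟩
    rw [(X.eval x).map_oplus, coe_oplus]
    push_cast
    rw [add_mul]
    exact (min_le_left _ _).trans (add_le_add (hk x) (hl x))
  mem_of_le := by
    rintro f f' ⟨k, hk⟩ h
    exact ⟨k, fun x => (le_iff.1 h x).trans (hk x)⟩

/-- A positive element of the chain can be replaced by one comparable to its square root. -/
theorem exists_chain_sqrt (x : X) (t : X.chain x) (ht : (0 : ℝ) < t.1) :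
    ∃ s : X.chain x, √(t.1 : ℝ) ≤ s.1 ∧ (s.1 : ℝ) ≤ 2 * √(t.1 : ℝ) := by
  obtain ⟨⟨t, ht1⟩, j, hj, hjt⟩ := t
  change t = _ at hjt
  change 0 < t at ht
  change ∃ s : X.chain x, √t ≤ s.1 ∧ (s.1 : ℝ) ≤ 2 * √t
  push_cast at hjt
  rw [add_sub_cancel_right] at hjt
  have hσ : (0 : ℝ) < X.mult x := by exact_mod_cast X.mult_pos x
  have hs1 : √t ≤ 1 := Real.sqrt_le_one.2 ht1.2
  have hts : t ≤ √t := by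
    calc t = √t * √t := (Real.mul_self_sqrt ht.le).symm
      _ ≤ √t * 1 := mul_le_mul_of_nonneg_left hs1 (Real.sqrt_nonneg t)
      _ = √t := mul_one _
  have hσt : 1 / (X.mult x : ℝ) ≤ t := by
    rw [hjt]
    refine (div_le_div_iff_of_pos_right hσ).2 ?_
    rw [hjt] at ht
    have : j ≠ 0 := by rintro rfl; simp at ht
    exact_mod_cast Nat.one_le_iff_ne_zero.2 this
  -- The witness is `√t` rounded up to the grid of mesh `1 / X.mult x`. The error is at most the
  -- mesh, which is at most `t ≤ √t`.
  have hc : ⌈√t * X.mult x⌉₊ ≤ X.mult x := by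
    rw [Nat.ceil_le]
    exact mul_le_of_le_one_left hσ.le hs1
  refine ⟨⟨⟨(⌈√t * X.mult x⌉₊ : ℝ) / X.mult x, by positivity, ?_⟩, ⌈√t * X.mult x⌉₊,
    Nat.lt_succ_of_le hc, by push_cast; rw [add_sub_cancel_right]⟩, ?_, ?_⟩
  · rw [div_le_one hσ]
    exact_mod_cast hc
  · exact (le_div_iff₀ hσ).2 (Nat.le_ceil _)
  · have h1 := Nat.ceil_lt_add_one (mul_nonneg (Real.sqrt_nonneg t) hσ.le)
    change (⌈√t * X.mult x⌉₊ : ℝ) / X.mult x ≤ _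
    calc (⌈√t * X.mult x⌉₊ : ℝ) / X.mult x ≤ (√t * X.mult x + 1) / X.mult x := by gcongr
      _ = √t + 1 / X.mult x := by rw [add_div, mul_div_cancel_right₀ _ hσ.ne']
      _ ≤ 2 * √t := by linarith

/-- The principal maximal ideals of a product of finite chains are the kernels of the
evaluations. -/
theorem exists_eq_ker_eval {M : Set (∀ x : X, X.chain x)} (hM : IsPrincipalMaximal M) :
    ∃ x, M = (X.eval x).ker := by
  obtain ⟨hM, a, ha⟩ := hM
  have haM : a ∈ M := ha ▸ mem_idealSpan_self a
  by_cases hz : ∃ x, X.eval x a = zero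
  · obtain ⟨x, hx⟩ := hz
    have hker := (X.eval x).isMaximalIdeal_ker
    refine ⟨x, hM.eq_of_subset _ hker.isIdeal hker.ne_univ ?_⟩
    rw [ha]
    exact hker.isIdeal.idealSpan_subset hx
  exfalso
  push Not at hz
  have hpos : ∀ x, (0 : ℝ) < X.eval x a := fun x =>
    lt_of_le_of_ne (X.eval x a).2.1 fun h0 => hz x (Subtype.ext h0.symm)
  -- Were `a` bounded away from zero, a multiple of it would be the constant `1` and `M` would not
  -- be proper.
  have hsmall : ∀ k : ℕ, ∃ x, k * (X.eval x a : ℝ) < 1 := by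
    by_contra! h
    obtain ⟨k, hk⟩ := h
    refine hM.ne_univ (hM.isIdeal.eq_univ ?_)
    refine hM.isIdeal.mem_of_le _ _ (hM.isIdeal.times_mem haM k) (le_iff.2 fun x => ?_)
    rw [(X.eval x).map_times, coe_times, min_eq_right (hk x)]
    exact (X.eval x _).2.2
  have hsmall' : ∀ k : ℕ, ∃ x, k * √(X.eval x a : ℝ) < 1 := fun k => by
    obtain ⟨x, hx⟩ := hsmall (k ^ 2)
    refine ⟨x, ?_⟩
    by_contra! h
    have := mul_self_le_mul_self zero_le_one h
    rw [mul_mul_mul_comm, Real.mul_self_sqrt (hpos x).le] at this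
    push_cast at hx
    nlinarith
  choose b hb1 hb2 using fun x => exists_chain_sqrt x (a x) (hpos x)
  have hJ := isIdeal_dominated (X := X) fun x => √(X.eval x a : ℝ)
  have hK := isIdeal_dominated (X := X) fun x => (X.eval x a : ℝ)
  -- The ideal of `√a` is proper and contains `a`, so maximality equates it with `M`. Then `b`,
  -- comparable to `√a`, is bounded by a multiple of `a`, which fails where `√a` is small.
  have hMJ := hM.eq_of_subset _ hJ (fun h => by
    obtain ⟨k, hk⟩ := Set.eq_univ_iff_forall.1 h (neg zero)
    obtain ⟨x, hx⟩ := hsmall' k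
    have := hk x
    rw [(X.eval x).map_neg, (X.eval x).map_zero, coe_neg, coe_zero] at this
    linarith) (by
    rw [ha]
    refine hJ.idealSpan_subset ⟨1, fun x => ?_⟩
    rw [Nat.cast_one, one_mul]
    exact Real.le_sqrt_of_sq_le (by nlinarith [(X.eval x a).2.1, (X.eval x a).2.2]))
  have hbM : b ∈ M := by
    rw [hMJ]
    exact ⟨2, fun x => hb2 x⟩
  rw [ha] at hbM
  obtain ⟨k, hk⟩ := hK.idealSpan_subset (a := a) ⟨1, fun x => by simp⟩ hbM
  obtain ⟨x, hx⟩ := hsmall' k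
  have h1 : √(X.eval x a : ℝ) ≤ k * X.eval x a := (hb1 x).trans (hk x)
  have h2 : 0 < √(X.eval x a : ℝ) := Real.sqrt_pos.2 (hpos x)
  have h3 : √(X.eval x a : ℝ) * √(X.eval x a : ℝ) = X.eval x a := Real.mul_self_sqrt (hpos x).le
  nlinarith

theorem reflectsPrincipalMaximal_pullback {X Y : MultisetCat.{u}} (φ : X ⟶ Y) :
    (MultisetCat.pullback φ).ReflectsPrincipalMaximal := by
  intro M hM
  obtain ⟨x, hx⟩ := exists_eq_ker_eval (X := X) hM
  have : (MultisetCat.pullback φ) ⁻¹' M = (Y.eval (φ.toFun x)).ker := by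
    rw [hx]
    rfl
  rw [this]
  exact isPrincipalMaximal_ker_eval (X := Y) (φ.toFun x)

/-- A homomorphism from a product of finite chains to `[0,1]` with principal maximal kernel is an
evaluation. -/
theorem exists_eval_eq {χ : MVAlgebra.Hom (∀ x : X, X.chain x) unitInterval}
    (hχ : IsPrincipalMaximal χ.ker) : ∃ x, X.eval x = χ := by
  obtain ⟨x, hx⟩ := exists_eq_ker_eval hχ
  exact ⟨x, MVAlgebra.Hom.eq_of_ker_subset (finite_range_eval x) hx.ge⟩

theorem eval_injective : Function.Injective X.eval := fun x y h => by
  by_contra hne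
  have h1 : (X.eval x (coatom y) : ℝ) = 1 := eval_coatom_of_ne hne
  rw [h, eval_coatom_self, coe_zero] at h1
  norm_num at h1

end MultisetCat

/-! ### Profinite MV-algebras are products of finite chains -/

/-- A bijective homomorphism is an isomorphism. -/
noncomputable def MVCat.isoOfBijective {A B : MVCat.{u}} (f : MVAlgebra.Hom A B)
    (hf : Function.Bijective f) : A ≅ B where
  hom := f
  inv :=
    { toFun := Function.surjInv hf.2
      map_zero := hf.1 (by rw [Function.surjInv_eq hf.2, f.map_zero])
      map_oplus := fun x y => hf.1 (by simp only [f.map_oplus, Function.surjInv_eq hf.2])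
      map_neg := fun x => hf.1 (by simp only [f.map_neg, Function.surjInv_eq hf.2]) }
  hom_inv_id := MVAlgebra.Hom.ext (funext (Function.leftInverse_surjInv hf))
  inv_hom_id := MVAlgebra.Hom.ext (funext (Function.rightInverse_surjInv hf.2))

/-! ### Elements of limits of MV-algebras -/

namespace MVCat

variable {A B : MVCat.{u}}

theorem inv_hom_apply (e : A ≅ B) (a : A) : e.inv.toFun (e.hom.toFun a) = a :=
  congrArg (fun f : MVAlgebra.Hom A A => f a) e.hom_inv_id

theorem hom_inv_apply (e : A ≅ B) (b : B) : e.hom.toFun (e.inv.toFun b) = b :=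
  congrArg (fun f : MVAlgebra.Hom B B => f b) e.inv_hom_id

variable {J : Type u} [Category.{u} J] {D : J ⥤ MVCat.{u}}

variable (D) in
/-- The compatible families of a diagram of MV-algebras. -/
def sectionsSubalg : Subalg (∀ j, D.obj j) where
  carrier := {b | ∀ i j (f : i ⟶ j), (D.map f).toFun (b i) = b j}
  zero_mem _ _ f := (D.map f).map_zero
  oplus_mem x hx y hy i j f := by
    change (D.map f).toFun (oplus (x i) (y i)) = oplus (x j) (y j)
    rw [(D.map f).map_oplus, hx i j f, hy i j f]
  neg_mem x hx i j f := by
    change (D.map f).toFun (neg (x i)) = neg (x j)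
    rw [(D.map f).map_neg, hx i j f]

variable (D) in
/-- The cone of compatible families. -/
def sectionsCone : Cone D where
  pt := ⟨sectionsSubalg D⟩
  π :=
    { app := fun j => ⟨fun b => b.1 j, rfl, fun _ _ => rfl, fun _ => rfl⟩
      naturality := fun i j f => MVAlgebra.Hom.ext (funext fun b => (b.2 i j f).symm) }

theorem exists_of_compatible {c : Cone D} (hc : IsLimit c) (b : ∀ j, D.obj j)
    (hb : ∀ i j (f : i ⟶ j), (D.map f).toFun (b i) = b j) :
    ∃ a : c.pt, ∀ j, (c.π.app j).toFun a = b j :=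
  ⟨(hc.lift (sectionsCone D)).toFun ⟨b, hb⟩, fun j =>
    congrArg (fun f : MVAlgebra.Hom (sectionsCone D).pt (D.obj j) => f ⟨b, hb⟩)
      (hc.fac (sectionsCone D) j)⟩

/-- Passing to the compatible families and lifting back is the identity of the limit, so the
coordinates determine an element. -/
theorem eq_of_forall_π_eq {c : Cone D} (hc : IsLimit c) {x y : c.pt}
    (h : ∀ j, (c.π.app j).toFun x = (c.π.app j).toFun y) : x = y := by
  let g : MVAlgebra.Hom c.pt (sectionsCone D).pt :=
    { toFun := fun a => ⟨fun j => (c.π.app j).toFun a, fun i j f =>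
        congrArg (fun f : MVAlgebra.Hom c.pt (D.obj j) => f a) (c.w f)⟩
      map_zero := Subtype.ext (funext fun j => (c.π.app j).map_zero)
      map_oplus := fun _ _ => Subtype.ext (funext fun j => (c.π.app j).map_oplus _ _)
      map_neg := fun _ => Subtype.ext (funext fun j => (c.π.app j).map_neg _) }
  let g' : c.pt ⟶ (sectionsCone D).pt := g
  have hid : g' ≫ hc.lift (sectionsCone D) = 𝟙 c.pt := hc.hom_ext fun j => by
    rw [Category.assoc, hc.fac, Category.id_comp]
    rfl
  have happ : ∀ a : c.pt, (hc.lift (sectionsCone D)).toFun (g a) = a := fun a =>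
    congrArg (fun f : MVAlgebra.Hom c.pt c.pt => f a) hid
  rw [← happ x, ← happ y]
  congr 1
  exact Subtype.ext (funext h)

end MVCat

theorem MVAlgebra.Hom.ncard_range {A : Type u} [MVAlgebra A] (χ : MVAlgebra.Hom A unitInterval)
    (h : (Set.range χ).Finite) :
    ∃ hpos : 0 < (Set.range χ).ncard - 1,
      Set.range χ =
        (lukChain ((Set.range χ).ncard - 1 + 1) (Nat.succ_le_succ hpos)).carrier := by
  obtain ⟨m, hm, hr⟩ := χ.range_eq_lukChain h
  have hc : (Set.range χ).ncard - 1 = m := by rw [hr, ncard_lukChain, Nat.add_sub_cancel]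
  subst hc
  exact ⟨hm, hr⟩

/-- Every profinite MV-algebra is a product of finite chains. -/
theorem IsProfiniteMV.exists_iso_prodMV {A : MVCat.{u}} (hA : IsProfiniteMV A) :
    ∃ X : MultisetCat.{u}, Nonempty (A ≅ X.prodMV) := by
  obtain ⟨I, _, _, D, c, hfin, ⟨hc⟩, ⟨e⟩⟩ := hA
  -- Factoring through a finite stage guarantees a finite range, and these homomorphisms already
  -- separate points.
  let T : Type u := {χ : MVAlgebra.Hom c.pt unitInterval //
    ∃ (i : Iᵒᵖ) (ψ : MVAlgebra.Hom (D.obj i) unitInterval), ψ.comp (c.π.app i) = χ}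
  have hT : ∀ χ : T, (Set.range χ.1).Finite := by
    rintro ⟨_, i, ψ, rfl⟩
    have := hfin i
    refine (Set.finite_range ψ).subset ?_
    rintro _ ⟨a, rfl⟩
    exact ⟨_, rfl⟩
  have hT' := fun χ : T => χ.1.ncard_range (hT χ)
  let X : MultisetCat.{u} := ⟨T, fun χ => (Set.range χ.1).ncard - 1, fun χ => (hT' χ).1⟩
  have hX : ∀ χ : X, Set.range χ.1 = (X.chain χ).carrier := fun χ => (hT' χ).2
  let Φ : MVAlgebra.Hom c.pt X.prodMV :=
    { toFun := fun a χ => ⟨χ.1 a, (hX χ).subset ⟨a, rfl⟩⟩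
      map_zero := funext fun χ => Subtype.ext χ.1.map_zero
      map_oplus := fun _ _ => funext fun χ => Subtype.ext (χ.1.map_oplus _ _)
      map_neg := fun _ => funext fun χ => Subtype.ext (χ.1.map_neg _) }
  refine ⟨X, ⟨e ≪≫ MVCat.isoOfBijective Φ ⟨fun x y hxy => ?_, fun f => ?_⟩⟩⟩
  · refine MVCat.eq_of_forall_π_eq hc fun i => ?_
    have := hfin i
    exact eq_of_forall_hom_eq fun ψ =>
      congrArg (fun f : ∀ χ : X, X.chain χ => (f ⟨ψ.comp (c.π.app i), i, ψ, rfl⟩).1) hxy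
  · classical
    have hd : ∀ χ : T, ∃ a, χ.1 a = (f χ).1 := fun χ => by
      exact (hX χ).superset (f χ).2
    choose d hd using hd
    let d' : MVAlgebra.Hom c.pt unitInterval → c.pt := fun χ =>
      if h : ∃ (i : Iᵒᵖ) (ψ : MVAlgebra.Hom (D.obj i) unitInterval), ψ.comp (c.π.app i) = χ
      then d ⟨χ, h⟩ else zero
    have hd' : ∀ χ : T, χ.1 (d' χ.1) = (f χ).1 := fun χ => by
      rw [← hd χ]
      simp only [d', dif_pos χ.2]
      rfl
    -- The remainder theorem is applied in the limit, not in `D.obj i`: the projection need not be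
    -- surjective, so distinct `ψ` may have the same composite with it.
    have happrox : ∀ i : Iᵒᵖ, ∃ b : D.obj i, ∀ ψ : MVAlgebra.Hom (D.obj i) unitInterval,
        ψ b = (f ⟨ψ.comp (c.π.app i), i, ψ, rfl⟩).1 := fun i => by
      have := hfin i
      have := finite_hom_unitInterval (A := D.obj i)
      obtain ⟨a, ha⟩ := MVAlgebra.Hom.exists_forall_map_eq
        (Set.finite_range fun ψ : MVAlgebra.Hom (D.obj i) unitInterval =>
          ψ.comp (c.π.app i)).toFinset
        (fun χ hχ => by
          obtain ⟨ψ, rfl⟩ := (Set.Finite.mem_toFinset _).1 hχ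
          exact hT ⟨_, i, ψ, rfl⟩) d'
      refine ⟨(c.π.app i).toFun a, fun ψ => ?_⟩
      rw [← hd' ⟨ψ.comp (c.π.app i), i, ψ, rfl⟩]
      exact ha _ ((Set.Finite.mem_toFinset _).2 ⟨ψ, rfl⟩)
    choose b hb using happrox
    -- Compatibility comes from uniqueness: the image of `b i` solves the same equations as `b j`,
    -- and homomorphisms separate points.
    obtain ⟨a, ha⟩ := MVCat.exists_of_compatible hc b fun i j g => by
      have := hfin j
      refine eq_of_forall_hom_eq fun ψ => ?_
      rw [hb j ψ]
      refine (hb i (ψ.comp (D.map g))).trans ?_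
      exact congrArg (fun χ : X => (f χ).1) (Subtype.ext
        (congrArg (fun h : MVAlgebra.Hom c.pt (D.obj j) => ψ.comp h) (c.w g)))
    refine ⟨a, funext ?_⟩
    rintro ⟨_, i, ψ, rfl⟩
    apply Subtype.ext
    change ψ ((c.π.app i).toFun a) = _
    rw [ha i, hb i ψ]

/-! ### Products of finite chains are profinite -/

namespace MultisetCat

variable (X : MultisetCat.{u})

/-- The finite subproduct `∏ x ∈ S, Ł_{σ(x)+1}`. -/
noncomputable abbrev subproduct (S : Finset X) : MVCat.{u} := ⟨∀ x : S, X.chain x.1⟩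

/-- The inverse system of the finite subproducts of `∏ x, Ł_{σ(x)+1}`. -/
noncomputable def subproducts : (Finset X)ᵒᵖ ⥤ MVCat.{u} where
  obj S := X.subproduct S.unop
  map {S T} g :=
    { toFun := fun (f : ∀ x : S.unop, X.chain x.1) (x : T.unop) => f ⟨x.1, g.unop.le x.2⟩
      map_zero := rfl
      map_oplus := fun _ _ => rfl
      map_neg := fun _ => rfl }
  map_id _ := rfl
  map_comp _ _ := rfl

/-- The product of all chains as a cone over the finite subproducts. -/
noncomputable def subproductsCone : Cone X.subproducts where
  pt := X.prodMV
  π :=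
    { app := fun S =>
        { toFun := fun (f : ∀ x : X, X.chain x) (x : S.unop) => f x.1
          map_zero := rfl
          map_oplus := fun _ _ => rfl
          map_neg := fun _ => rfl }
      naturality := fun _ _ _ => rfl }

variable {X} in
/-- The factor of index `x` of a cone over the finite subproducts. -/
noncomputable def coneFactor (s : Cone X.subproducts) (x : X) :
    MVAlgebra.Hom s.pt (X.chain x) :=
  let g : MVAlgebra.Hom s.pt (X.subproduct {x}) := s.π.app (Opposite.op {x})
  let x' : ({x} : Finset X) := ⟨x, Finset.mem_singleton_self x⟩
  { toFun := fun a => (show ∀ y : ({x} : Finset X), X.chain y.1 from g a) x'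
    map_zero := congrFun g.map_zero x'
    map_oplus := fun a b => congrFun (g.map_oplus a b) x'
    map_neg := fun a => congrFun (g.map_neg a) x' }

/-- The product of all chains is the limit of the finite subproducts. -/
noncomputable def isLimitSubproductsCone : IsLimit X.subproductsCone where
  lift s :=
    { toFun := fun a x => coneFactor s x a
      map_zero := funext fun x => (coneFactor s x).map_zero
      map_oplus := fun a b => funext fun x => (coneFactor s x).map_oplus a b
      map_neg := fun a => funext fun x => (coneFactor s x).map_neg a }
  fac s S := by
    refine MVAlgebra.Hom.ext (funext fun a => funext fun x : S.unop => ?_)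
    have hx : ({x.1} : Finset X) ≤ S.unop := Finset.singleton_subset_iff.2 x.2
    -- Restricting from `S` to a singleton shows that the singleton stages determine the cone.
    have := s.w (Quiver.Hom.op (homOfLE hx) : S ⟶ Opposite.op {x.1})
    exact (congrArg (fun f : MVAlgebra.Hom s.pt (X.subproduct {x.1}) =>
      (show ∀ y : ({x.1} : Finset X), X.chain y.1 from f a)
        ⟨x.1, Finset.mem_singleton_self x.1⟩) this).symm
  uniq s m hm := by
    refine MVAlgebra.Hom.ext (funext fun a => funext fun x : X => ?_)
    exact congrArg (fun f : MVAlgebra.Hom s.pt (X.subproduct {x}) =>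
      (show ∀ y : ({x} : Finset X), X.chain y.1 from f a)
        ⟨x, Finset.mem_singleton_self x⟩) (hm (Opposite.op {x}))

theorem isProfiniteMV_prodMV : IsProfiniteMV X.prodMV := by
  refine ⟨Finset X, inferInstance, ?_, X.subproducts, X.subproductsCone, fun S => ?_,
    ⟨X.isLimitSubproductsCone⟩, ⟨Iso.refl X.prodMV⟩⟩
  · classical infer_instance
  · have := fun x : S.unop => (finite_lukChain _ (Nat.succ_le_succ (X.mult_pos x))).to_subtype
    exact Pi.finite

end MultisetCat

/-! ### The duality -/

/-- Transported to a product of chains, `χ` becomes an evaluation. -/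
theorem HF.finite_range {A : ProfMV.{u}} (χ : HF A) : (Set.range χ.1).Finite := by
  obtain ⟨X, ⟨e⟩⟩ := A.profinite.exists_iso_prodMV
  let g : MVAlgebra.Hom (∀ x : X, X.chain x) A := e.inv
  have hg : g.ReflectsPrincipalMaximal :=
    reflectsPrincipalMaximal_of_inverse g e.hom (MVCat.hom_inv_apply e) (MVCat.inv_hom_apply e)
  obtain ⟨x, hx⟩ := MultisetCat.exists_eval_eq (χ := χ.1.comp g) (hg _ χ.2)
  refine (MultisetCat.finite_range_eval x).subset ?_
  rintro _ ⟨a, rfl⟩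
  refine ⟨e.hom.toFun a, ?_⟩
  rw [hx]
  exact congrArg χ.1 (MVCat.inv_hom_apply e a)

theorem sigmaHF_pos (A : ProfMV.{u}) (χ : HF A) : 0 < sigmaHF A χ :=
  (χ.1.ncard_range χ.finite_range).1

theorem HF.range_eq {A : ProfMV.{u}} (χ : HF A) :
    Set.range χ.1 =
      (lukChain (sigmaHF A χ + 1) (Nat.succ_le_succ (sigmaHF_pos A χ))).carrier :=
  (χ.1.ncard_range χ.finite_range).2

theorem sigmaHF_precomp_dvd (A B : ProfMV.{u}) (φ : B ⟶ A) (χ : HF A) :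
    sigmaHF B (HF.precomp φ χ) ∣ sigmaHF A χ := by
  refine dvd_of_lukChain_subset (sigmaHF_pos _ _) (sigmaHF_pos _ _) ?_
  rw [← HF.range_eq, ← HF.range_eq]
  rintro _ ⟨b, rfl⟩
  exact ⟨_, rfl⟩

/-- The functor `ℋ : ℙᵒᵖ ⥤ 𝕄`. -/
noncomputable abbrev toMultiset : ProfMV.{u}ᵒᵖ ⥤ MultisetCat.{u} :=
  functorH (fun A χ => ⟨χ.finite_range, sigmaHF_pos A χ⟩) sigmaHF_precomp_dvd

/-- The functor `ℱ : 𝕄 ⥤ ℙᵒᵖ`. -/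
noncomputable abbrev toProfMV : MultisetCat.{u} ⥤ ProfMV.{u}ᵒᵖ :=
  functorF MultisetCat.isProfiniteMV_prodMV
    fun _ _ φ => MultisetCat.reflectsPrincipalMaximal_pullback φ

/-- A multiplicity preserving bijection is an isomorphism of multisets. -/
noncomputable def MultisetCat.isoOfBijective {X Y : MultisetCat.{u}} (f : X → Y)
    (hf : Function.Bijective f) (hmult : ∀ x, Y.mult (f x) = X.mult x) : X ≅ Y where
  hom := ⟨f, fun x => (hmult x).dvd⟩
  inv := ⟨Function.surjInv hf.2, fun y => by
    rw [← hmult, Function.surjInv_eq hf.2]⟩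
  hom_inv_id := MultisetCat.Hom.ext (funext (Function.leftInverse_surjInv hf))
  inv_hom_id := MultisetCat.Hom.ext (funext (Function.rightInverse_surjInv hf.2))

/-- The point `f ↦ f x` of `ℋ (ℱ X)`. -/
noncomputable def MultisetCat.evalHF (X : MultisetCat.{u}) (x : X) : HF (toProfMV.obj X).unop :=
  ⟨X.eval x, X.isPrincipalMaximal_ker_eval x⟩

theorem MultisetCat.evalHF_bijective (X : MultisetCat.{u}) : Function.Bijective X.evalHF := by
  refine ⟨fun x y h => MultisetCat.eval_injective (congrArg Subtype.val h), fun χ => ?_⟩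
  obtain ⟨x, hx⟩ := MultisetCat.exists_eval_eq (X := X) (χ := χ.1) χ.2
  exact ⟨x, Subtype.ext hx⟩

theorem MultisetCat.sigmaHF_evalHF (X : MultisetCat.{u}) (x : X) :
    sigmaHF _ (X.evalHF x) = X.mult x := by
  change (Set.range (X.eval x)).ncard - 1 = _
  rw [MultisetCat.range_eval, ncard_lukChain, Nat.add_sub_cancel]

/-- The unit `η_X(x)(f) = f(x)`. -/
noncomputable def unitIsoEval : 𝟭 MultisetCat.{u} ≅ toProfMV ⋙ toMultiset :=
  NatIso.ofComponents
    (fun X => MultisetCat.isoOfBijective X.evalHF X.evalHF_bijective X.sigmaHF_evalHF)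
    fun _ => rfl

/-- The homomorphism `ε_A(a)(χ) = χ(a)`. -/
noncomputable def evalHom (A : ProfMV.{u}) :
    MVAlgebra.Hom A (toMultiset.obj (Opposite.op A)).prodMV where
  toFun a χ := ⟨χ.1 a, (HF.range_eq χ).subset ⟨a, rfl⟩⟩
  map_zero := funext fun χ => Subtype.ext χ.1.map_zero
  map_oplus _ _ := funext fun χ => Subtype.ext (χ.1.map_oplus _ _)
  map_neg _ := funext fun χ => Subtype.ext (χ.1.map_neg _)

theorem reflectsPrincipalMaximal_evalHom (A : ProfMV.{u}) :
    (evalHom A).ReflectsPrincipalMaximal := by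
  intro M hM
  obtain ⟨χ, hχ⟩ := MultisetCat.exists_eq_ker_eval (X := toMultiset.obj (Opposite.op A)) hM
  have : evalHom A ⁻¹' M = χ.1.ker := by
    rw [hχ]
    rfl
  rw [this]
  exact χ.2

/-- The counit `ε_A(a)(χ) = χ(a)` as a natural transformation. -/
noncomputable def counitEval : toMultiset ⋙ toProfMV ⟶ 𝟭 ProfMV.{u}ᵒᵖ where
  app A := Quiver.Hom.op (V := ProfMV.{u}) ⟨evalHom A.unop, reflectsPrincipalMaximal_evalHom A.unop⟩
  naturality _ _ _ := rfl

theorem map_unit_comp_counit (X : MultisetCat.{u}) :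
    toProfMV.map (unitIsoEval.hom.app X) ≫ counitEval.app (toProfMV.obj X) =
      𝟙 (toProfMV.obj X) := rfl

/-- An isomorphism of MV-algebras is an isomorphism of `ℙ`. -/
def ProfMV.isoMk {A B : ProfMV.{u}} (e : A.toMV ≅ B.toMV) : A ≅ B where
  hom := ⟨e.hom, reflectsPrincipalMaximal_of_inverse e.hom e.inv (MVCat.inv_hom_apply e)
    (MVCat.hom_inv_apply e)⟩
  inv := ⟨e.inv, reflectsPrincipalMaximal_of_inverse e.inv e.hom (MVCat.hom_inv_apply e)
    (MVCat.inv_hom_apply e)⟩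
  hom_inv_id := ProfMV.Hom.ext e.hom_inv_id
  inv_hom_id := ProfMV.Hom.ext e.inv_hom_id

/-- Naturality reduces to `A = ℱ X`, where the triangle identity makes the counit inverse to the
image of the invertible unit. -/
theorem isIso_counitEval_app (A : ProfMV.{u}ᵒᵖ) : IsIso (counitEval.app A) := by
  obtain ⟨X, ⟨e⟩⟩ := A.unop.profinite.exists_iso_prodMV
  let e' : toProfMV.obj X ≅ A := (ProfMV.isoMk (B := (toProfMV.obj X).unop) e).op
  rw [← NatTrans.isIso_app_iff_of_iso counitEval e']
  have : IsIso (toProfMV.map (unitIsoEval.hom.app X) ≫ counitEval.app (toProfMV.obj X)) := by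
    rw [map_unit_comp_counit]
    exact IsIso.id (toProfMV.obj X)
  exact IsIso.of_isIso_comp_left (toProfMV.map (unitIsoEval.hom.app X)) _

/-- The counit as a natural isomorphism. -/
noncomputable def counitIsoEval : toMultiset ⋙ toProfMV ≅ 𝟭 ProfMV.{u}ᵒᵖ :=
  have := isIso_counitEval_app
  have : IsIso counitEval := NatIso.isIso_of_isIso_app counitEval
  asIso counitEval

theorem corollary4p6 :
    -- `ℋ` and `ℱ` are well defined,
    ∃ (hσ : ∀ (A : ProfMV.{u}) (χ : HF A), (Set.range χ.1).Finite ∧ 0 < sigmaHF A χ)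
      (hdvd : ∀ (A B : ProfMV.{u}) (φ : B ⟶ A) (χ : HF A),
        sigmaHF B (HF.precomp φ χ) ∣ sigmaHF A χ)
      (hprof : ∀ X : MultisetCat.{u}, IsProfiniteMV X.prodMV)
      (hrefl : ∀ (X Y : MultisetCat.{u}) (φ : X ⟶ Y),
        (MultisetCat.pullback φ).ReflectsPrincipalMaximal),
    -- and they form an equivalence `𝕄 ≌ ℙᵒᵖ`,
    ∃ (η : 𝟭 MultisetCat.{u} ≅ functorF hprof hrefl ⋙ functorH hσ hdvd)
      (ε : functorH hσ hdvd ⋙ functorF hprof hrefl ≅ 𝟭 ProfMV.{u}ᵒᵖ)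
      (tri : ∀ X : MultisetCat.{u},
        (functorF hprof hrefl).map (η.hom.app X) ≫ ε.hom.app ((functorF hprof hrefl).obj X) =
          𝟙 ((functorF hprof hrefl).obj X)),
    let e : MultisetCat.{u} ≌ ProfMV.{u}ᵒᵖ :=
      { functor := functorF hprof hrefl
        inverse := functorH hσ hdvd
        unitIso := η
        counitIso := ε
        functor_unitIso_comp := tri }
    -- with unit `η_X(x)(f) = f(x)` and counit given by `ε_A(a)(χ) = χ(a)`.
    (∀ (X : MultisetCat.{u}) (x : X) (f : ∀ x : X, X.chain x),
      ((e.unit.app X).toFun x).1 f = (f x).1) ∧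
    (∀ (A : ProfMV.{u}) (a : A) (χ : HF A),
      ((e.counit.app (Opposite.op A)).unop.hom a χ).1 = χ.1 a) := by
  exact ⟨fun A χ => ⟨χ.finite_range, sigmaHF_pos A χ⟩, sigmaHF_precomp_dvd,
    MultisetCat.isProfiniteMV_prodMV,
    fun _ _ φ => MultisetCat.reflectsPrincipalMaximal_pullback φ,
    unitIsoEval, counitIsoEval, map_unit_comp_counit,
    fun _ _ _ => rfl, fun _ _ _ => rfl⟩
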